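/- **Setting.** Let $\mathcal X$ be a second-countable topological space with its Borel $\sigma$-algebra, let $\mathcal Y=\{1,\dots,K\}$, and let $P$ be a probability measure on $\mathcal X\times\mathcal Y$, the law of a pair $(X,Y)$. Fix $k\in\mathcal Y$ with $P(Y=k)>0$ and let $P_{X|k}$ be the law of $X$ conditioned on $Y=k$. Suppose that the support $\mathcal X_k$ of $P_{X|k}$ is (via a topological embedding into $\mathcal X$) a finite-dimensional, second-countable smooth Riemannian manifold, with geodesic distance $d$; put $d(x',x)=\infty$ if $x$ or $x'$ is not in $\mathcal X_k$. Suppose that, for some $\sigma_k>0$, $P_{X|k}$ satisfies $\mathrm T_2(\sigma_k^2)$ on $(\mathcal X_k,d)$, that is, it has a finite second moment and $$W_2(\nu,P_{X|k})\le\sqrt{2\sigma_k^2\,\mathrm{KL}(\nu\,\|\,P_{X|k})}\quad\text{for every probability measure }\nu\ll P_{X|k}.$$ Let $h:\mathcal X\to\mathcal Y$ be measurable, with accuracy $\mathrm{acc}(h|k):=P_{X|k}(h(X)=k)<1$ and error $\mathrm{err}(h|k):=1-\mathrm{acc}(h|k)$, and put $B(h,k)=\{x: h(x)\ne k\}$,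 $\epsilon(h|k):=\sigma_k\sqrt{2\log(1/\mathrm{err}(h|k))}$, $d(h|k):=\mathbb E_{P_{X|k}}\big[\inf_{x'\in B(h,k)}d(X,x')\big]$ and $$\mathrm{acc}_\epsilon(h|k):=P_{X|k}\big(h(x')=k\ \text{for all }x'\text{ with }d(x',X)\le\epsilon\big).$$ **Distributional robustness accuracy.** For a law $R$ on $\mathcal X\times\mathcal Y$ and $\epsilon\ge0$ put $$\widetilde{\mathrm{acc}}_\epsilon(h;R):=\inf\{\,Q(h(x)=y)\;:\;Q\text{ a probability measure on }\mathcal X\times\mathcal Y,\ W_1(Q,R)\le\epsilon\,\},$$ where $W_1$ is taken with respect to the cost $\tilde d((x',y'),(x,y))=d(x',x)$ if $y'=y$ and $\infty$ otherwise (so labels cannot be changed). Let $\widetilde{\mathrm{acc}}_\epsilon(h|k)$ be $\widetilde{\mathrm{acc}}_\epsilon(h;R)$ for $R$ the law of $(X,Y)$ conditioned on $Y=k$. **Corollary (No "Free Lunch" for distributional robustness).** Under these assumptions: 1. For every $\epsilon\ge0$, $\ \widetilde{\mathrm{acc}}_\epsilon(h|k)\le\mathrm{acc}_\epsilon(h|k)$.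 2. (A) If $\epsilon\ge\epsilon(h|k)$, then $$\widetilde{\mathrm{acc}}_\epsilon(h|k)\le\min\Big(\mathrm{acc}(h|k),\,e^{-\frac1{2\sigma_k^2}(\epsilon-\epsilon(h|k))^2}\Big).$$ 3. (B) The average distance to the error set satisfies $$d(h|k)\le\sigma_k\Big(\sqrt{2\log(1/\mathrm{err}(h|k))}+\sqrt{\pi/2}\Big),$$ and the same bound holds for the distributional counterpart $\int_0^\infty\widetilde{\mathrm{acc}}_\epsilon(h|k)\,d\epsilon$. -/

import Mathlib

open MeasureTheory
open scoped ENNReal ContDiff Bundle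

noncomputable section

namespace NoFreeLunch

/-- The couplings of `ν` and `μ`: measures on the product with first marginal `ν` and second
marginal `μ`. -/
def couplings {α : Type*} [MeasurableSpace α] (ν μ : Measure α) : Set (Measure (α × α)) :=
  {γ | γ.map Prod.fst = ν ∧ γ.map Prod.snd = μ}

/-- The Wasserstein `p`-distance `(inf_γ 𝔼_γ[d(X', X)^p])^(1/p)` between `ν` and `μ`, with respect
to an extended-valued (pseudo-)distance `d`. -/
def wasserstein {α : Type*} [MeasurableSpace α] (p : ℝ) (d : α → α → ℝ≥0∞) (ν μ : Measure α) :
    ℝ≥0∞ :=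
  (⨅ γ ∈ couplings ν μ, ∫⁻ z, d z.1 z.2 ^ p ∂γ) ^ (1 / p)

/-- Talagrand's transportation-cost inequality `T₂(c)` for `μ` on the metric space `M`:
`μ` has a finite second moment and `W₂(ν, μ) ≤ √(2 c KL(ν ‖ μ))` for every probability measure
`ν ≪ μ`. -/
def TalagrandT2 {M : Type*} [EMetricSpace M] [MeasurableSpace M] (c : ℝ) (μ : Measure M) : Prop :=
  (∃ a : M, ∫⁻ x, edist a x ^ (2 : ℝ) ∂μ < ⊤) ∧
  ∀ ν : Measure M, IsProbabilityMeasure ν → ν ≪ μ →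
    wasserstein 2 (fun x y : M => edist x y) ν μ ≤
      (ENNReal.ofReal (2 * c) * InformationTheory.klDiv ν μ) ^ (1 / 2 : ℝ)

section Classification

variable {X : Type*} [MeasurableSpace X] {K : ℕ}

/-- The law of `(X, Y)` conditioned on `Y = k`, when `(X, Y)` has law `P`. -/
def condLaw (P : Measure (X × Fin K)) (k : Fin K) : Measure (X × Fin K) :=
  ProbabilityTheory.cond P {z | z.2 = k}

/-- The class-conditional law `P_{X|k}` of the features `X` given `Y = k`. -/
def classDist (P : Measure (X × Fin K)) (k : Fin K) : Measure X :=
  (condLaw P k).map Prod.fst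

/-- Class-conditional accuracy `acc(h|k)`. -/
def classAcc (P : Measure (X × Fin K)) (h : X → Fin K) (k : Fin K) : ℝ :=
  (classDist P k).real {x | h x = k}

/-- Class-conditional error `err(h|k) = 1 - acc(h|k)`. -/
def classErr (P : Measure (X × Fin K)) (h : X → Fin K) (k : Fin K) : ℝ :=
  1 - classAcc P h k

/-- The critical tolerance `ε(h|k) = σ √(2 log(1 / err(h|k)))`. -/
def criticalEps (σ : ℝ) (P : Measure (X × Fin K)) (h : X → Fin K) (k : Fin K) : ℝ :=
  σ * √(2 * Real.log (1 / classErr P h k))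

/-- Adversarial robustness accuracy `acc_ε(h|k)` for the threat model of the distance `d`. -/
def advAcc (d : X → X → ℝ≥0∞) (P : Measure (X × Fin K)) (h : X → Fin K) (k : Fin K) (ε : ℝ) :
    ℝ≥0∞ :=
  classDist P k {x | ∀ x', d x' x ≤ ENNReal.ofReal ε → h x' = k}

/-- The average distance `d(h|k) = 𝔼_{X|k}[d(X, B(h,k))]` to the error set
`B(h,k) = {x | h x ≠ k}`. -/
def avgDist (d : X → X → ℝ≥0∞) (P : Measure (X × Fin K)) (h : X → Fin K) (k : Fin K) : ℝ≥0∞ :=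
  ∫⁻ x, (⨅ x' ∈ {x' | h x' ≠ k}, d x x') ∂(classDist P k)

/-- The distance on `X × {1, …, K}` that forbids changing the label: `d x' x` if the labels agree,
and `∞` otherwise. -/
def labelDist (d : X → X → ℝ≥0∞) (z' z : X × Fin K) : ℝ≥0∞ :=
  if z'.2 = z.2 then d z'.1 z.1 else ⊤

/-- Distributional robustness accuracy of `h` under the data law `P` at tolerance `ε`: the infimum
of `Q(h(x) = y)` over all probability measures `Q` on `X × {1, …, K}` with `W₁(Q, P) ≤ ε`. -/
def distAcc (d : X → X → ℝ≥0∞) (P : Measure (X × Fin K)) (h : X → Fin K) (ε : ℝ) : ℝ≥0∞ :=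
  ⨅ (Q : Measure (X × Fin K)) (_ : IsProbabilityMeasure Q)
    (_ : wasserstein 1 (labelDist d) Q P ≤ ENNReal.ofReal ε), Q {z | h z.1 = z.2}

/-- Class-conditional distributional robustness accuracy: the data law is the law of `(X, Y)`
conditioned on `Y = k`. -/
def classDistAcc (d : X → X → ℝ≥0∞) (P : Measure (X × Fin K)) (h : X → Fin K) (k : Fin K)
    (ε : ℝ) : ℝ≥0∞ :=
  distAcc d (condLaw P k) h ε

end Classification

/-- The distance of the metric space `M`, seen through an injection `ι : M → X` as an extended
distance between points of `X`; it is `∞` as soon as one of the points is outside `ι(M)`. -/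
def distVia {M X : Type*} [EMetricSpace M] (ι : M → X) (x x' : X) : ℝ≥0∞ :=
  ⨅ (a : M) (b : M) (_ : ι a = x) (_ : ι b = x'), edist a b

end NoFreeLunch

end

open ProbabilityTheory

namespace NoFreeLunch

/-! ### Relative entropy of conditioned measures -/

section Entropy

variable {α : Type*} [MeasurableSpace α]

/-! This is Marton's argument. Conditioning `μ` on `A` costs entropy `log (1 / μ A)`, so T₂ bounds
the transport cost from `cond μ A` to `μ`. The distance to the error set `A` is 1-Lipschitz and
vanishes on `A`, so its `μ`-mean is at most the critical radius. Conditioning instead on the points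
at distance at least `ε` from `A` gives the Gaussian tail (`TalagrandT2.measure_le_infEDist_le`).

The distributional adversary does as well as the pointwise one: points of `A` move for free, and the
budget saved pays for near-optimal moves where the distance to `A` is not attained
(`exists_measurable_transport`). Its accuracy is thus at most the mass beyond distance `ε`. This
gives the comparison with `advAcc`, the tail bound and, by the layer-cake formula, the integral
bound. -/

lemma llr_cond_ae_eq (μ : Measure α) [IsFiniteMeasure μ] {A : Set α} (hA : MeasurableSet A)
    (hμA : μ A ≠ 0) :
    llr (cond μ A) μ =ᵐ[cond μ A] fun _ => Real.log (1 / μ.real A) := by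
  have h1 : (cond μ A).rnDeriv μ =ᵐ[μ] (μ A)⁻¹ • A.indicator 1 :=
    (Measure.rnDeriv_smul_left_of_ne_top (μ.restrict A) μ (ENNReal.inv_ne_top.2 hμA)).trans
      ((Measure.rnDeriv_restrict_self μ hA).const_smul _)
  filter_upwards [cond_absolutelyContinuous.ae_le h1, ae_cond_mem hA] with x hx hxA
  simp [llr, hx, hxA, Measure.real]

/-- The relative entropy of a conditional law with respect to the unconditional one. -/
lemma klDiv_cond (μ : Measure α) [IsProbabilityMeasure μ] {A : Set α} (hA : MeasurableSet A)
    (hμA : μ A ≠ 0) :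
    InformationTheory.klDiv (cond μ A) μ = ENNReal.ofReal (Real.log (1 / μ.real A)) := by
  have := cond_isProbabilityMeasure hμA
  have hae := llr_cond_ae_eq μ hA hμA
  rw [InformationTheory.klDiv_of_ac_of_integrable cond_absolutelyContinuous
    ((integrable_const _).congr hae.symm), integral_congr_ae hae]
  simp

end Entropy

/-! ### Transport inequalities and concentration on the manifold -/

section Transport

variable {M : Type*} [EMetricSpace M] [MeasurableSpace M]

variable {σ : ℝ} {μ : Measure M} [IsProbabilityMeasure μ]

lemma TalagrandT2.wasserstein_cond_le (hσ : 0 < σ) (hT : TalagrandT2 (σ ^ 2) μ) {A : Set M}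
    (hA : MeasurableSet A) (hμA : μ A ≠ 0) :
    wasserstein 2 (fun x y : M => edist x y) (cond μ A) μ ≤
      ENNReal.ofReal (σ * √(2 * Real.log (1 / μ.real A))) := by
  refine (hT.2 _ (cond_isProbabilityMeasure hμA) cond_absolutelyContinuous).trans ?_
  rw [klDiv_cond μ hA hμA, ← ENNReal.ofReal_mul (by positivity),
    ENNReal.ofReal_rpow_of_nonneg _ (by norm_num), ← Real.sqrt_eq_rpow, mul_comm 2 (σ ^ 2),
    mul_assoc, Real.sqrt_mul (by positivity), Real.sqrt_sq hσ.le]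
  have : 0 ≤ Real.log (1 / μ.real A) := by
    rw [one_div, Real.log_inv, neg_nonneg]
    exact Real.log_nonpos measureReal_nonneg measureReal_le_one
  positivity

variable [SecondCountableTopology M] [BorelSpace M]

/-- The mean distance to a set changes by at most the quadratic transport cost. -/
lemma lintegral_infEDist_le_add_wasserstein (A : Set M) (ν μ : Measure M)
    [IsProbabilityMeasure ν] :
    ∫⁻ x, Metric.infEDist x A ∂μ ≤
        ∫⁻ x, Metric.infEDist x A ∂ν + wasserstein 2 (fun x y => edist x y) ν μ ∧
      ∫⁻ x, Metric.infEDist x A ∂ν ≤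
        ∫⁻ x, Metric.infEDist x A ∂μ + wasserstein 2 (fun x y => edist x y) ν μ := by
  have hf : Measurable fun x : M => Metric.infEDist x A := measurable_infEDist
  have key : ∀ a b : ℝ≥0∞, (∀ γ ∈ couplings ν μ, a ≤ b + ∫⁻ z, edist z.1 z.2 ∂γ) →
      a ≤ b + wasserstein 2 (fun x y => edist x y) ν μ := by
    intro a b hab
    -- Isolating the infimum over couplings lets each coupling be treated separately.
    rw [← tsub_le_iff_left, wasserstein, one_div, ENNReal.le_rpow_inv_iff (by norm_num)]
    refine le_iInf₂ fun γ hγ => ?_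
    have hγp : IsProbabilityMeasure γ := by
      refine ⟨?_⟩
      have h1 : γ.map Prod.fst Set.univ = 1 := by rw [hγ.1]; simp
      rwa [Measure.map_apply measurable_fst MeasurableSet.univ, Set.preimage_univ] at h1
    rw [← ENNReal.le_rpow_inv_iff (by norm_num)]
    refine (tsub_le_iff_left.2 (hab γ hγ)).trans ?_
    -- Cauchy–Schwarz against the constant 1: on a probability space the mean cost is at most the
    -- quadratic cost.
    have := ENNReal.lintegral_mul_le_Lp_mul_Lq γ Real.HolderConjugate.two_two
      (f := fun z : M × M => edist z.1 z.2) (g := fun _ => 1)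
      measurable_edist.aemeasurable aemeasurable_const
    simpa using this
  have hfst : ∀ γ ∈ couplings ν μ, ∫⁻ x, Metric.infEDist x A ∂ν =
      ∫⁻ z, Metric.infEDist z.1 A ∂γ := fun γ hγ => by
    rw [← hγ.1, lintegral_map hf measurable_fst]
  have hsnd : ∀ γ ∈ couplings ν μ, ∫⁻ x, Metric.infEDist x A ∂μ =
      ∫⁻ z, Metric.infEDist z.2 A ∂γ := fun γ hγ => by
    rw [← hγ.2, lintegral_map hf measurable_snd]
  refine ⟨key _ _ fun γ hγ => ?_, key _ _ fun γ hγ => ?_⟩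
  · rw [hfst γ hγ, hsnd γ hγ,
      ← lintegral_add_left (f := fun z : M × M => Metric.infEDist z.1 A) (hf.comp measurable_fst)]
    refine lintegral_mono fun z => ?_
    rw [edist_comm]
    exact Metric.infEDist_le_infEDist_add_edist
  · rw [hfst γ hγ, hsnd γ hγ,
      ← lintegral_add_left (f := fun z : M × M => Metric.infEDist z.2 A) (hf.comp measurable_snd)]
    exact lintegral_mono fun z => Metric.infEDist_le_infEDist_add_edist

/-- Under `T₂`, the mean distance to a set is controlled by the measure of the set. -/
lemma TalagrandT2.lintegral_infEDist_le (hσ : 0 < σ) (hT : TalagrandT2 (σ ^ 2) μ) {A : Set M}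
    (hA : MeasurableSet A) (hμA : μ A ≠ 0) :
    ∫⁻ x, Metric.infEDist x A ∂μ ≤ ENNReal.ofReal (σ * √(2 * Real.log (1 / μ.real A))) := by
  have := cond_isProbabilityMeasure hμA
  refine (lintegral_infEDist_le_add_wasserstein A (cond μ A) μ).1.trans ?_
  have h0 : ∫⁻ x, Metric.infEDist x A ∂(cond μ A) = 0 := by
    rw [lintegral_eq_zero_iff measurable_infEDist]
    filter_upwards [ae_cond_mem hA] with x hx using Metric.infEDist_zero_of_mem hx
  rw [h0, zero_add]
  exact hT.wasserstein_cond_le hσ hA hμA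

/-- Gaussian concentration under `T₂`: the blow-ups of a set `A` fill the space at a Gaussian rate
beyond the critical radius. -/
lemma TalagrandT2.measure_le_infEDist_le (hσ : 0 < σ) (hT : TalagrandT2 (σ ^ 2) μ) {A : Set M}
    (hA : MeasurableSet A) (hμA : μ A ≠ 0) {ε : ℝ}
    (hε : σ * √(2 * Real.log (1 / μ.real A)) ≤ ε) :
    μ {x | ENNReal.ofReal ε ≤ Metric.infEDist x A} ≤
      ENNReal.ofReal (Real.exp (-(1 / (2 * σ ^ 2)) *
        (ε - σ * √(2 * Real.log (1 / μ.real A))) ^ 2)) := by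
  set B := {x | ENNReal.ofReal ε ≤ Metric.infEDist x A} with hBdef
  set c := σ * √(2 * Real.log (1 / μ.real A)) with hc
  have hB : MeasurableSet B := measurableSet_le measurable_const measurable_infEDist
  rcases eq_or_ne (μ B) 0 with hμB | hμB
  · simp [hμB]
  have := cond_isProbabilityMeasure hμB
  have hc0 : 0 ≤ c := by positivity
  have h1 : ENNReal.ofReal ε ≤ ∫⁻ x, Metric.infEDist x A ∂(cond μ B) := by
    calc ENNReal.ofReal ε = ∫⁻ _, ENNReal.ofReal ε ∂(cond μ B) := by simp
      _ ≤ _ := lintegral_mono_ae (ae_cond_mem hB)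
  have h2 : ENNReal.ofReal ε ≤
      ENNReal.ofReal (c + σ * √(2 * Real.log (1 / μ.real B))) := by
    rw [ENNReal.ofReal_add hc0 (by positivity)]
    exact (h1.trans (lintegral_infEDist_le_add_wasserstein A (cond μ B) μ).2).trans
      (add_le_add (hT.lintegral_infEDist_le hσ hA hμA) (hT.wasserstein_cond_le hσ hB hμB))
  rw [ENNReal.ofReal_le_ofReal_iff (by positivity)] at h2
  have hpos : 0 < μ.real B := ENNReal.toReal_pos hμB (measure_ne_top _ _)
  have hlog : 0 ≤ 2 * Real.log (1 / μ.real B) := by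
    rw [one_div, Real.log_inv]
    linarith [Real.log_nonpos hpos.le (measureReal_le_one (μ := μ) (s := B))]
  have h3 : (ε - c) ^ 2 ≤ σ ^ 2 * (2 * Real.log (1 / μ.real B)) := by
    rw [← Real.sq_sqrt hlog, ← mul_pow]
    exact pow_le_pow_left₀ (by linarith) (by linarith) 2
  rw [← ofReal_measureReal]
  refine ENNReal.ofReal_le_ofReal ((Real.log_le_iff_le_exp hpos).1 ?_)
  rw [one_div (μ.real B), Real.log_inv] at h3
  have : 1 / (2 * σ ^ 2) * (ε - c) ^ 2 ≤ -Real.log (μ.real B) := by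
    rw [div_mul_eq_mul_div, one_mul, div_le_iff₀ (by positivity)]
    linarith
  linarith

/-- The points at distance at most `ε` from `A` can be moved measurably into `A`, at a mean cost of
at most `ε`: a set of positive measure leaves room for near-optimal choices. -/
lemma exists_measurable_transport {A : Set M} (hA : MeasurableSet A) (hμA : μ A ≠ 0) {ε : ℝ}
    (hε : 0 < ε) :
    ∃ T : M → M, Measurable T ∧ (∀ x, Metric.infEDist x A ≤ ENNReal.ofReal ε → T x ∈ A) ∧
      ∫⁻ x, edist (T x) x ∂μ ≤ ENNReal.ofReal ε := by
  classical
  have hp : 0 < μ.real A := ENNReal.toReal_pos hμA (measure_ne_top _ _)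
  have : Nonempty A := (nonempty_of_measure_ne_zero hμA).to_subtype
  -- With `p = μ.real A`, only mass at most `1 - p` moves, each point by at most `ε (1 + p)`; the
  -- total `ε (1 - p ^ 2)` is within budget.
  set r : ℝ≥0∞ := ENNReal.ofReal (ε * (1 + μ.real A)) with hr
  have hεr : ENNReal.ofReal ε < r :=
    (ENNReal.ofReal_lt_ofReal_iff (by positivity)).2 (by nlinarith)
  -- The points left in place: already in `A`, or too far from it. The others go to the first close
  -- enough term of a dense sequence in `A`, which keeps the map measurable.
  let D : Set M := A ∪ {x | ENNReal.ofReal ε < Metric.infEDist x A}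
  have hD : MeasurableSet D := hA.union (measurableSet_lt measurable_const measurable_infEDist)
  let a : ℕ → M := fun n => TopologicalSpace.denseSeq A n
  have hex : ∀ x, ∃ n, x ∈ D ∨ edist (a n) x < r := by
    intro x
    by_cases hx : x ∈ D
    · exact ⟨0, .inl hx⟩
    have hxA : Metric.infEDist x A < r :=
      (not_lt.1 fun h => hx (.inr h)).trans_lt hεr
    obtain ⟨y, hyA, hy⟩ := Metric.infEDist_lt_iff.1 hxA
    have hopen : IsOpen {z : A | edist (z : M) x < r} :=
      isOpen_lt (by fun_prop) continuous_const
    obtain ⟨n, hn⟩ := (TopologicalSpace.denseRange_denseSeq A).exists_mem_open hopen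
      ⟨⟨y, hyA⟩, by simpa [edist_comm] using hy⟩
    exact ⟨n, .inr hn⟩
  let f : ℕ → M → M := fun n x => if x ∈ D then x else a n
  refine ⟨fun x => f (Nat.find (hex x)) x, ?_, fun x hx => ?_, ?_⟩
  · refine Measurable.find (f := f) (p := fun n x => x ∈ D ∨ edist (a n) x < r)
      (fun n => Measurable.ite hD measurable_id measurable_const) (fun n => ?_) hex
    exact hD.union (measurableSet_lt (f := fun x => edist (a n) x) (by fun_prop) measurable_const)
  · by_cases hxD : x ∈ D
    · rcases hxD with h | h
      · simp [f, D, h]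
      · exact absurd h (not_lt.2 hx)
    · simp [f, hxD, a]
  · have hle : ∀ x, edist (f (Nat.find (hex x)) x) x ≤ Aᶜ.indicator (fun _ => r) x := by
      intro x
      by_cases hxD : x ∈ D
      · simp [f, hxD]
      · have hxA : x ∉ A := fun h => hxD (.inl h)
        simpa [f, hxD, hxA] using ((Nat.find_spec (hex x)).resolve_left hxD).le
    refine (lintegral_mono hle).trans ?_
    rw [lintegral_indicator_const hA.compl, ← ofReal_measureReal (μ := μ) (s := Aᶜ),
      probReal_compl_eq_one_sub hA, hr, ← ENNReal.ofReal_mul (by positivity)]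
    exact ENNReal.ofReal_le_ofReal (by nlinarith [sq_nonneg (μ.real A)])

end Transport

lemma distVia_apply {M X : Type*} [EMetricSpace M] {ι : M → X} (hι : Function.Injective ι)
    (a b : M) : distVia ι (ι a) (ι b) = edist a b := by
  refine le_antisymm (iInf₂_le_of_le a b (iInf₂_le_of_le rfl rfl le_rfl)) ?_
  refine le_iInf₂ fun a' b' => le_iInf₂ fun ha hb => ?_
  rw [hι ha, hι hb]

/-! ### From the manifold to the classifier -/

section Classification

variable {X : Type*} [MeasurableSpace X] {K : ℕ} (P : Measure (X × Fin K)) (k : Fin K)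

lemma measurableSet_label : MeasurableSet {z : X × Fin K | z.2 = k} :=
  measurable_snd (measurableSet_singleton k)

lemma condLaw_eq_map [IsFiniteMeasure P] :
    condLaw P k = (classDist P k).map fun x => (x, k) := by
  rw [classDist, Measure.map_map (by fun_prop) measurable_fst]
  conv_lhs => rw [← Measure.map_id (μ := condLaw P k)]
  refine Measure.map_congr ?_
  filter_upwards [ae_cond_mem (μ := P) (measurableSet_label k)] with z hz
  exact Prod.ext rfl hz

variable {P k}

lemma isProbabilityMeasure_classDist [IsFiniteMeasure P] (hk : P {z | z.2 = k} ≠ 0) :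
    IsProbabilityMeasure (classDist P k) := by
  have : IsProbabilityMeasure (condLaw P k) := cond_isProbabilityMeasure hk
  exact Measure.isProbabilityMeasure_map measurable_fst.aemeasurable

variable {M : Type*} [EMetricSpace M] [MeasurableSpace M] {μ : Measure M}
  {ι : M → X} {h : X → Fin K}

/-- A measurable displacement of the manifold gives an admissible perturbation of the data law. -/
lemma classDistAcc_le_of_transport [IsFiniteMeasure P] [IsProbabilityMeasure μ]
    (hι : MeasurableEmbedding ι) (hμ : classDist P k = μ.map ι)
    (hh : Measurable h) {T : M → M}
    (hT : Measurable T) {ε : ℝ} (hcost : ∫⁻ x, edist (T x) x ∂μ ≤ ENNReal.ofReal ε) :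
    classDistAcc (distVia ι) P h k ε ≤ μ {x | h (ι (T x)) = k} := by
  have hm : Measurable fun x => (ι (T x), k) := (hι.measurable.comp hT).prodMk measurable_const
  have hm' : Measurable fun x => (ι x, k) := hι.measurable.prodMk measurable_const
  have hlaw : condLaw P k = μ.map fun x => (ι x, k) := by
    rw [condLaw_eq_map, hμ, Measure.map_map (by fun_prop) hι.measurable]; rfl
  refine iInf₂_le_of_le (μ.map fun x => (ι (T x), k))
    (Measure.isProbabilityMeasure_map hm.aemeasurable) (iInf_le_of_le ?_ ?_)
  · rw [wasserstein, div_one, ENNReal.rpow_one]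
    refine iInf₂_le_of_le (μ.map fun x => ((ι (T x), k), (ι x, k))) ⟨?_, ?_⟩ ?_
    · rw [Measure.map_map measurable_fst (hm.prodMk hm')]; rfl
    · rw [Measure.map_map measurable_snd (hm.prodMk hm'), hlaw]; rfl
    -- This inequality holds without measurability of the labelled cost.
    · refine (lintegral_map_le _ _).trans (le_of_eq_of_le ?_ hcost)
      simp [labelDist, distVia_apply hι.injective]
  · rw [Measure.map_apply hm]
    · rfl
    · exact measurableSet_eq_fun (hh.comp measurable_fst) measurable_snd

lemma classDistAcc_le_measure_eq [IsFiniteMeasure P] [IsProbabilityMeasure μ]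
    (hι : MeasurableEmbedding ι) (hμ : classDist P k = μ.map ι)
    (hh : Measurable h) {ε : ℝ} :
    classDistAcc (distVia ι) P h k ε ≤ μ {x | h (ι x) = k} :=
  classDistAcc_le_of_transport hι hμ hh measurable_id (by simp)

/-- The distributional accuracy is at most the mass of the points at distance more than `ε` from
the error set. -/
lemma classDistAcc_le_measure_lt_infEDist [IsFiniteMeasure P] [SecondCountableTopology M]
    [BorelSpace M]
    [IsProbabilityMeasure μ]
    (hι : MeasurableEmbedding ι) (hμ : classDist P k = μ.map ι)
    (hh : Measurable h) (herr : μ {x | h (ι x) ≠ k} ≠ 0) {ε : ℝ}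
    (hε : 0 < ε) :
    classDistAcc (distVia ι) P h k ε ≤
      μ {x | ENNReal.ofReal ε < Metric.infEDist x {x | h (ι x) ≠ k}} := by
  have hA : MeasurableSet {x | h (ι x) ≠ k} :=
    (hh.comp hι.measurable) (measurableSet_singleton k).compl
  obtain ⟨T, hT, hTA, hcost⟩ := exists_measurable_transport hA herr hε
  refine (classDistAcc_le_of_transport hι hμ hh hT hcost).trans (measure_mono fun x hx => ?_)
  exact not_le.1 fun hle => hTA x hle hx

lemma advAcc_eq (hι : MeasurableEmbedding ι) (hμ : classDist P k = μ.map ι) (ε : ℝ) :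
    advAcc (distVia ι) P h k ε =
      μ {x | ∀ x', edist x' x ≤ ENNReal.ofReal ε → h (ι x') = k} := by
  rw [advAcc, hμ, hι.map_apply]
  congr 1
  ext x
  refine ⟨fun hx x' hx' => hx _ (by rwa [distVia_apply hι.injective]), fun hx x' hx' => ?_⟩
  by_cases hr : x' ∈ Set.range ι
  · obtain ⟨y, rfl⟩ := hr
    exact hx y (by rwa [distVia_apply hι.injective] at hx')
  · have : distVia ι x' (ι x) = ⊤ := by
      simp only [distVia, iInf_eq_top]
      exact fun a b ha => absurd ⟨a, ha⟩ hr
    simp [this] at hx'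

lemma classDistAcc_le_advAcc [IsFiniteMeasure P] [SecondCountableTopology M] [BorelSpace M]
    [IsProbabilityMeasure μ] (hι : MeasurableEmbedding ι) (hμ : classDist P k = μ.map ι)
    (hh : Measurable h) (herr : μ {x | h (ι x) ≠ k} ≠ 0) {ε : ℝ} (hε : 0 ≤ ε) :
    classDistAcc (distVia ι) P h k ε ≤ advAcc (distVia ι) P h k ε := by
  rw [advAcc_eq hι hμ]
  rcases hε.eq_or_lt with rfl | hε
  -- At `ε = 0` there is no slack to spend, but the closed ball is a single point.
  · refine (classDistAcc_le_measure_eq hι hμ hh).trans (measure_mono fun x hx x' hx' => ?_)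
    rw [ENNReal.ofReal_zero, nonpos_iff_eq_zero, edist_eq_zero] at hx'
    rwa [hx']
  · refine (classDistAcc_le_measure_lt_infEDist hι hμ hh herr hε).trans
      (measure_mono fun x hx x' hx' => ?_)
    by_contra hne
    rw [edist_comm] at hx'
    exact (hx.trans_le (Metric.infEDist_le_edist_of_mem hne)).not_ge hx'

lemma avgDist_le_lintegral_infEDist (hι : MeasurableEmbedding ι)
    (hμ : classDist P k = μ.map ι) :
    avgDist (distVia ι) P h k ≤ ∫⁻ x, Metric.infEDist x {x | h (ι x) ≠ k} ∂μ := by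
  rw [avgDist, hμ]
  refine (lintegral_map_le _ _).trans (lintegral_mono fun x => ?_)
  refine le_iInf₂ fun y hy => iInf₂_le_of_le (ι y) hy ?_
  rw [distVia_apply hι.injective]

/-- Layer cake: the mean distance is the integral over `ε` of the tail masses, each of which
dominates the distributional accuracy. -/
lemma lintegral_classDistAcc_le [IsFiniteMeasure P] [SecondCountableTopology M] [BorelSpace M]
    [IsProbabilityMeasure μ] (hι : MeasurableEmbedding ι) (hμ : classDist P k = μ.map ι)
    (hh : Measurable h) (herr : μ {x | h (ι x) ≠ k} ≠ 0) :
    ∫⁻ ε in Set.Ioi (0 : ℝ), classDistAcc (distVia ι) P h k ε ≤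
      ∫⁻ x, Metric.infEDist x {x | h (ι x) ≠ k} ∂μ := by
  set f : M → ℝ≥0∞ := fun x => Metric.infEDist x {x | h (ι x) ≠ k} with hf
  have hfm : Measurable f := measurable_infEDist
  -- Almost-everywhere finiteness is needed because `toReal` sends `⊤` to 0.
  rcases eq_or_ne (∫⁻ x, f x ∂μ) ⊤ with htop | htop
  · rw [htop]; exact le_top
  have hfin : ∀ᵐ x ∂μ, f x < ⊤ := ae_lt_top hfm htop
  have hcake := lintegral_eq_lintegral_meas_le μ (f := fun x => (f x).toReal)
    (.of_forall fun _ => ENNReal.toReal_nonneg) hfm.ennreal_toReal.aemeasurable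
  have hcongr : ∫⁻ x, ENNReal.ofReal (f x).toReal ∂μ = ∫⁻ x, f x ∂μ :=
    lintegral_congr_ae (hfin.mono fun x hx => ENNReal.ofReal_toReal hx.ne)
  rw [← hcongr, hcake]
  refine setLIntegral_mono' measurableSet_Ioi fun ε hε => ?_
  refine (classDistAcc_le_measure_lt_infEDist hι hμ hh herr hε).trans (measure_mono_ae ?_)
  filter_upwards [hfin] with x hx hlt
  exact (ENNReal.ofReal_le_iff_le_toReal hx.ne).1 (le_of_lt hlt)

end Classification

end NoFreeLunch

/-- No free lunch for distributional robustness, in the geodesic threat model. The support of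
`P_{X|k}` is a Riemannian manifold `M`, embedded by `ι` in the feature space `X`; its geodesic
distance is `edist`. -/
theorem mainTheorem3
    {X : Type*} [TopologicalSpace X] [SecondCountableTopology X] [MeasurableSpace X] [BorelSpace X]
    {K : ℕ} (P : Measure (X × Fin K)) [IsProbabilityMeasure P]
    (k : Fin K) (hk : P {z | z.2 = k} ≠ 0)
    {E : Type*} [NormedAddCommGroup E] [NormedSpace ℝ E] [FiniteDimensional ℝ E]
    {H : Type*} [TopologicalSpace H] (I : ModelWithCorners ℝ E H)
    {M : Type*} [EMetricSpace M] [SecondCountableTopology M] [ChartedSpace H M] [IsManifold I ∞ M]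
    [Bundle.RiemannianBundle (fun x : M => TangentSpace I x)]
    [IsContMDiffRiemannianBundle I ∞ E (fun x : M => TangentSpace I x)]
    [IsRiemannianManifold I M]
    [MeasurableSpace M] [BorelSpace M]
    (ι : M → X) (hι : Topology.IsEmbedding ι)
    (hsupp : Set.range ι = (NoFreeLunch.classDist P k).support)
    (σ : ℝ) (hσ : 0 < σ)
    (hT2 : NoFreeLunch.TalagrandT2 (σ ^ 2) ((NoFreeLunch.classDist P k).comap ι))
    (h : X → Fin K) (hh : Measurable h) (hacc : NoFreeLunch.classAcc P h k < 1) :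
    (∀ ε : ℝ, 0 ≤ ε →
      NoFreeLunch.classDistAcc (NoFreeLunch.distVia ι) P h k ε ≤
        NoFreeLunch.advAcc (NoFreeLunch.distVia ι) P h k ε) ∧
    (∀ ε : ℝ, NoFreeLunch.criticalEps σ P h k ≤ ε →
      NoFreeLunch.classDistAcc (NoFreeLunch.distVia ι) P h k ε ≤
        ENNReal.ofReal (min (NoFreeLunch.classAcc P h k)
          (Real.exp (-(1 / (2 * σ ^ 2)) * (ε - NoFreeLunch.criticalEps σ P h k) ^ 2)))) ∧
    NoFreeLunch.avgDist (NoFreeLunch.distVia ι) P h k ≤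
      ENNReal.ofReal (σ * (√(2 * Real.log (1 / NoFreeLunch.classErr P h k)) + √(Real.pi / 2))) ∧
    ∫⁻ ε in Set.Ioi (0 : ℝ), NoFreeLunch.classDistAcc (NoFreeLunch.distVia ι) P h k ε ≤
      ENNReal.ofReal (σ * (√(2 * Real.log (1 / NoFreeLunch.classErr P h k)) + √(Real.pi / 2))) := by
  -- A support is closed, so `ι` is a closed embedding, hence a measurable one.
  have hrange : IsClosed (Set.range ι) := hsupp ▸ Measure.isClosed_support
  have hme : MeasurableEmbedding ι :=
    Topology.IsClosedEmbedding.measurableEmbedding ⟨hι, hrange⟩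
  have hprob := NoFreeLunch.isProbabilityMeasure_classDist hk
  have hμ : NoFreeLunch.classDist P k = ((NoFreeLunch.classDist P k).comap ι).map ι := by
    rw [hme.map_comap, hsupp, Measure.restrict_eq_self_of_ae_mem]
    exact Measure.support_mem_ae
  set μ := (NoFreeLunch.classDist P k).comap ι
  have hμp : IsProbabilityMeasure μ := by
    refine ⟨?_⟩
    have h1 : (NoFreeLunch.classDist P k) Set.univ = 1 := measure_univ
    rwa [hμ, Measure.map_apply hme.measurable MeasurableSet.univ, Set.preimage_univ] at h1
  have hA : MeasurableSet {x | h (ι x) ≠ k} :=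
    (hh.comp hme.measurable) (measurableSet_singleton k).compl
  have hacc_eq : NoFreeLunch.classAcc P h k = μ.real {x | h (ι x) = k} := by
    rw [NoFreeLunch.classAcc, hμ, Measure.real, hme.map_apply]; rfl
  have herr : NoFreeLunch.classErr P h k = μ.real {x | h (ι x) ≠ k} := by
    rw [NoFreeLunch.classErr, hacc_eq, ← probReal_compl_eq_one_sub]
    · rfl
    · exact (hh.comp hme.measurable) (measurableSet_singleton k)
  have hμA : μ {x | h (ι x) ≠ k} ≠ 0 := by
    intro h0
    rw [NoFreeLunch.classErr, Measure.real, h0, ENNReal.toReal_zero] at herr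
    linarith
  have hmean := hT2.lintegral_infEDist_le hσ hA hμA
  rw [← herr] at hmean
  -- The mean is already below the critical radius; the `√(π / 2)` term is pure slack.
  replace hmean := hmean.trans (ENNReal.ofReal_le_ofReal
    (mul_le_mul_of_nonneg_left (le_add_of_nonneg_right (Real.sqrt_nonneg (Real.pi / 2))) hσ.le))
  have h1 := fun (ε : ℝ) (hε : 0 ≤ ε) =>
    NoFreeLunch.classDistAcc_le_advAcc hme hμ hh hμA hε
  refine ⟨h1, fun ε hε => ?_,
    (NoFreeLunch.avgDist_le_lintegral_infEDist hme hμ).trans hmean,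
    (NoFreeLunch.lintegral_classDistAcc_le hme hμ hh hμA).trans hmean⟩
  rw [ENNReal.ofReal_min]
  refine le_min ?_ ?_
  · rw [hacc_eq, ofReal_measureReal]
    exact NoFreeLunch.classDistAcc_le_measure_eq hme hμ hh
  · have hε0 : 0 ≤ ε := le_trans (by unfold NoFreeLunch.criticalEps; positivity) hε
    rw [NoFreeLunch.criticalEps, herr] at hε ⊢
    refine le_trans ?_ (hT2.measure_le_infEDist_le hσ hA hμA hε)
    -- At `ε = 0` the set on the right is the whole space.
    rcases hε0.eq_or_lt with rfl | hε0
    · simpa using (NoFreeLunch.classDistAcc_le_measure_eq hme hμ hh).trans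
        (measure_mono (Set.subset_univ _))
    · exact (NoFreeLunch.classDistAcc_le_measure_lt_infEDist hme hμ hh hμA hε0).trans
        (measure_mono (Set.ofPred_subset_ofPred.2 fun x hx => le_of_lt hx))
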